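/- Let $d\ge 0$ be an integer, let $X\subset\mathbb R^d$ be compact, and let $\sigma:\mathbb R\to\mathbb R$ be Lipschitz and not a polynomial. (1) Let $\mu$ be a Borel measure on $\mathbb R^d\times\mathbb R=\mathbb R^{d+1}$ that gives positive mass to every nonempty open set and satisfies $\int(\|w\|_2^2+|b|^2)\,d\mu(w,b)<\infty$. Let $\mathcal F$ be the set of all functions on $X$ of the form $f(x)=\int a(w,b)\,\sigma(\langle w,x\rangle+b)\,d\mu(w,b)$, where $a$ satisfies $\int|a|^2\,d\mu<\infty$ and the integral converges absolutely for every $x\in X$. If $\mu$ is finite (in particular, if it is a probability measure), this convergence is automatic for every $a\in L^2(\mu)$. Then $\mathcal F\subset C(X)$, and $\mathcal F$ is dense in $C(X)$ in the uniform norm. (2) Let $m\ge1$ and consider the network $$f(x;\theta)=\frac1{\sqrt m}\sum_{\ell=1}^m a_\ell\,\sigma(\langle w_\ell,x\rangle+b_\ell)+b_0,\qquad \theta=(a,W,b,b_0)\in\mathbb R^{md+2m+1},$$ where $w_\ell$ is the $\ell$-th row of $W\in\mathbb R^{m\times d}$. Let all the parameters be initialized independently, with $(w_\ell,b_\ell)\sim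 N(0,I_{d+1})$ and $a_\ell\sim\mathcal A$ for every $\ell$, and $b_0\sim\mathcal B'$, where $\mathcal A$ is a probability distribution on $\mathbb R$ with finite second moment and $\mathcal B'$ is any probability distribution on $\mathbb R$. Then for every $x\in X$ the map $\theta\mapsto f(x;\theta)$ is almost surely differentiable at the initialization, and the neural tangent kernel $$K^\infty(x,x')=\mathbb E\left[\left\langle\frac{\partial f(x;\theta)}{\partial\theta},\frac{\partial f(x';\theta)}{\partial\theta}\right\rangle\right],\qquad x,x'\in X,$$ is well defined, the random variable inside the expectation being integrable. Moreover, for every finite Borel measure $\rho$ on $X$, the operator $T_{K^\infty}f(x)=\int_X K^\infty(x,s)f(s)\,d\rho(s)$ is well defined from $L^2(\rho)$ to $L^2(\rho)$ and is strictly positive: $\langle f,T_{K^\infty}f\rangle_{L^2(\rho)}>0$ for every $f\ne0$ in $L^2(\rho)$. -/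

import Mathlib

open MeasureTheory ProbabilityTheory

namespace NTK

/-- The space `ℝ^d` with its Euclidean norm. -/
abbrev Vec (d : ℕ) : Type := EuclideanSpace ℝ (Fin d)

/-- The class of infinite-width networks `x ↦ ∫ a(w,b) σ(⟨w,x⟩ + b) dμ(w,b)` on `X`, where `a`
ranges over `L²(μ)` and the integral converges absolutely at every `x ∈ X`. -/
def infiniteWidthNetworks {d : ℕ} (σ : ℝ → ℝ) (μ : Measure (Vec d × ℝ)) (X : Set (Vec d)) :
    Set (X → ℝ) :=
  {f | ∃ a : Vec d × ℝ → ℝ, MemLp a 2 μ ∧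
    ∀ x : X, Integrable (fun θ => a θ * σ (inner ℝ θ.1 (x : Vec d) + θ.2)) μ ∧
      f x = ∫ θ, a θ * σ (inner ℝ θ.1 (x : Vec d) + θ.2) ∂μ}

/-- The scalar parameters of a network of width `m` on `ℝ^d`: the outer weights `a_ℓ`, the inner
weights `W_{ℓ,i}`, the inner biases `b_ℓ`, and the outer bias `b₀`. -/
abbrev ParamIdx (m d : ℕ) : Type := Fin m ⊕ (Fin m × Fin d) ⊕ Fin m ⊕ Unit

/-- The parameter space `ℝ^p`, `p = md + 2m + 1`, with its Euclidean structure. -/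
abbrev Param (m d : ℕ) : Type := EuclideanSpace ℝ (ParamIdx m d)

variable {m d : ℕ}

/-- The outer weight `a_ℓ`. -/
def outerWeight (θ : Param m d) (l : Fin m) : ℝ := θ (Sum.inl l)

/-- The inner weight vector `w_ℓ`. -/
def innerWeight (θ : Param m d) (l : Fin m) : Vec d :=
  WithLp.toLp 2 fun i => θ (Sum.inr (Sum.inl (l, i)))

/-- The inner bias `b_ℓ`. -/
def innerBias (θ : Param m d) (l : Fin m) : ℝ := θ (Sum.inr (Sum.inr (Sum.inl l)))

/-- The outer bias `b₀`. -/
def outerBias (θ : Param m d) : ℝ := θ (Sum.inr (Sum.inr (Sum.inr ())))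

/-- The shallow network `f(x;θ) = m^{-1/2} ∑_ℓ a_ℓ σ(⟨w_ℓ,x⟩ + b_ℓ) + b₀`. -/
noncomputable def network (σ : ℝ → ℝ) (θ : Param m d) (x : Vec d) : ℝ :=
  (1 / Real.sqrt m) *
    ∑ l, outerWeight θ l * σ (inner ℝ (innerWeight θ l) x + innerBias θ l) + outerBias θ

/-- `⟨∂_θ f(x;θ), ∂_θ f(x';θ)⟩`, the tangent kernel at the parameter `θ`. -/
noncomputable def tangentKernelAt (σ : ℝ → ℝ) (θ : Param m d) (x x' : Vec d) : ℝ :=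
  inner ℝ (gradient (fun η : Param m d => network σ η x) θ)
    (gradient (fun η : Param m d => network σ η x') θ)

/-- The analytical neural tangent kernel `K^∞(x,x') = 𝔼⟨∂_θ f(x;θ), ∂_θ f(x';θ)⟩` for parameters
initialized according to `P`. -/
noncomputable def tangentKernel (σ : ℝ → ℝ) (P : Measure (Param m d)) (x x' : Vec d) : ℝ :=
  ∫ θ, tangentKernelAt σ θ x x' ∂P

/-- The laws of the individual parameters: `a_ℓ ∼ A`, `W_{ℓ,i} ∼ N(0,1)`, `b_ℓ ∼ N(0,1)`,
`b₀ ∼ B`. -/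
noncomputable def paramLaw (A B : Measure ℝ) : ParamIdx m d → Measure ℝ
  | Sum.inl _ => A
  | Sum.inr (Sum.inl _) => gaussianReal 0 1
  | Sum.inr (Sum.inr (Sum.inl _)) => gaussianReal 0 1
  | Sum.inr (Sum.inr (Sum.inr _)) => B

/-- The law of the initialization: all parameters independent, with `(w_ℓ, b_ℓ) ∼ N(0, I_{d+1})`,
`a_ℓ ∼ A` and `b₀ ∼ B`. -/
noncomputable def gaussianInit (m d : ℕ) (A B : Measure ℝ) : Measure (Param m d) :=
  (Measure.pi (paramLaw (m := m) (d := d) A B)).map (WithLp.toLp 2)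

/-- `T_K f(x) = ∫ K(x,s) f(s) dρ(s)`. -/
noncomputable def integralOperator {Y : Type*} [MeasurableSpace Y] (K : Y → Y → ℝ)
    (ρ : Measure Y) (f : Y → ℝ) (x : Y) : ℝ :=
  ∫ s, K x s * f s ∂ρ

/-- `T_K` is a well-defined operator on `L²(ρ)` that is strictly positive:
`⟨f, T_K f⟩ > 0` for all `f ≠ 0` in `L²(ρ)`. -/
def IsStrictlyPositive {Y : Type*} [MeasurableSpace Y] (K : Y → Y → ℝ) (ρ : Measure Y) : Prop :=
  ∀ f : Lp ℝ 2 ρ, (∀ x, Integrable (fun s => K x s * f s) ρ) ∧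
    ∃ h : MemLp (integralOperator K ρ f) 2 ρ, f ≠ 0 → 0 < inner ℝ f (h.toLp _)

end NTK

/-! Both parts rest on one fact, `eq_zero_of_ridge_eq_zero`: a bounded functional ℓ on C(X) that
kills every ridge function σ(⟨w,·⟩ + b) is zero. Averaging over b shows that ℓ also kills the ridge
functions of each mollification τ of σ. Some τ is not a polynomial: a Lipschitz polynomial is
affine, and pointwise limits of affine functions are affine. Differentiating k times in w along v,
then setting w = 0 and b = t, gives τ^(k)(t) ℓ(⟨v,·⟩^k) = 0. A t with τ^(k)(t) ≠ 0 exists for every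
k, so ℓ kills all powers of linear forms, hence their exponentials, and Stone–Weierstrass gives ℓ =
0.

For (1), averages of ridge functions over small balls of parameters are networks, so ridge functions
lie in the closure of the networks, and Hahn–Banach gives density. For (2), ⟨f, T f⟩ = 𝔼‖∫ f(x) ∂_θ
f(x;θ) dρ(x)‖². If this vanishes, the a_ℓ-component makes f orthogonal to σ(⟨w,·⟩ + b) for almost
every (w,b), hence for every (w,b) by continuity and the full support of the Gaussian; the fact
above then forces f = 0. -/

namespace NTK

open Filter Topology Polynomial
open scoped ContDiff Convolution

/-! ### Mollifications of a Lipschitz non-polynomial function. -/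

section Affine

/-- Every real polynomial is the derivative of a polynomial. -/
theorem exists_derivative_eq (p : ℝ[X]) : ∃ q : ℝ[X], derivative q = p := by
  induction p using Polynomial.induction_on' with
  | add p q hp hq =>
    obtain ⟨p', rfl⟩ := hp
    obtain ⟨q', rfl⟩ := hq
    exact ⟨p' + q', by simp⟩
  | monomial n a =>
    refine ⟨monomial (n + 1) (a / (n + 1)), ?_⟩
    rw [derivative_monomial]
    simp only [Nat.add_sub_cancel]
    congr 1
    push_cast
    field_simp

/-- A smooth function with a vanishing iterated derivative is a polynomial. -/
theorem exists_polynomial_of_iteratedDeriv_eq_zero (k : ℕ) {τ : ℝ → ℝ} (hτ : ContDiff ℝ ∞ τ)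
    (h : ∀ t, iteratedDeriv k τ t = 0) : ∃ p : ℝ[X], ∀ t, τ t = p.eval t := by
  induction k generalizing τ with
  | zero => exact ⟨0, fun t => by simpa using h t⟩
  | succ k ih =>
    obtain ⟨p, hp⟩ := ih (τ := deriv τ) (ContDiff.iterate_deriv 1 hτ)
      (fun t => by rw [← iteratedDeriv_succ']; exact h t)
    obtain ⟨q, rfl⟩ := exists_derivative_eq p
    have hd : Differentiable ℝ τ := hτ.differentiable (by simp)
    have hc := is_const_of_deriv_eq_zero (f := fun t => τ t - q.eval t)
      (hd.sub q.differentiable) fun t => by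
        rw [deriv_fun_sub (hd t) q.differentiableAt, hp t, Polynomial.deriv, sub_self]
    refine ⟨q + C (τ 0 - q.eval 0), fun t => ?_⟩
    have := hc t 0
    simp only [eval_add, eval_C]
    linarith

/-- A smooth Lipschitz function with a vanishing iterated derivative is affine. -/
theorem affine_of_lipschitzWith_of_iteratedDeriv_eq_zero {L : NNReal} {τ : ℝ → ℝ}
    (hL : LipschitzWith L τ) (hτ : ContDiff ℝ ∞ τ) {k : ℕ} (h : ∀ t, iteratedDeriv k τ t = 0)
    (t : ℝ) : τ t = τ 0 + t * (τ 1 - τ 0) := by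
  obtain ⟨p, hp⟩ := exists_polynomial_of_iteratedDeriv_eq_zero k hτ h
  obtain rfl : τ = fun t => p.eval t := funext hp
  have hb : IsBoundedUnder (· ≤ ·) atTop fun t => |p.derivative.eval t| := by
    refine isBoundedUnder_of ⟨L, fun t => ?_⟩
    rw [← Polynomial.deriv]
    exact norm_deriv_le_of_lipschitz hL
  -- A polynomial that stays bounded at +∞ is constant; here it is p'.
  rw [isBoundedUnder_abs_atTop_iff] at hb
  have hdeg : p.natDegree ≤ 1 := by
    have h0 := natDegree_eq_zero_iff_degree_le_zero.2 hb
    rw [natDegree_derivative] at h0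
    omega
  have hlin := Polynomial.eq_X_add_C_of_natDegree_le_one hdeg
  rw [hlin]
  simp
  ring

/-- The mollification of a Lipschitz function is Lipschitz with the same constant. -/
theorem lipschitzWith_mollify {L : NNReal} {σ : ℝ → ℝ} (hL : LipschitzWith L σ)
    (φ : ContDiffBump (0 : ℝ)) :
    LipschitzWith L (φ.normed volume ⋆[ContinuousLinearMap.lsmul ℝ ℝ, volume] σ) := by
  refine LipschitzWith.of_dist_le_mul fun s t => ?_
  have hi : ∀ r, Integrable fun u => φ.normed volume u * σ (r - u) := fun r =>
    (φ.continuous_normed.mul (hL.continuous.comp (by fun_prop))).integrable_of_hasCompactSupport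
      φ.hasCompactSupport_normed.mul_right
  simp only [convolution_def, ContinuousLinearMap.lsmul_apply, smul_eq_mul]
  rw [dist_eq_norm, ← integral_sub (hi s) (hi t)]
  calc ‖∫ u, φ.normed volume u * σ (s - u) - φ.normed volume u * σ (t - u)‖
      ≤ ∫ u, φ.normed volume u * (L * dist s t) := by
        refine norm_integral_le_of_norm_le (φ.integrable_normed.mul_const _)
          (Eventually.of_forall fun u => ?_)
        rw [← mul_sub, norm_mul, Real.norm_of_nonneg (φ.nonneg_normed u)]
        refine mul_le_mul_of_nonneg_left ?_ (φ.nonneg_normed u)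
        have := hL.dist_le_mul (s - u) (t - u)
        rwa [dist_sub_right, dist_eq_norm] at this
    _ = L * dist s t := by rw [integral_mul_const, φ.integral_normed, one_mul]

/-- A Lipschitz function that is not a polynomial has a mollification none of whose derivatives
vanishes identically. -/
theorem exists_mollify_iteratedDeriv_ne_zero {L : NNReal} {σ : ℝ → ℝ} (hL : LipschitzWith L σ)
    (hpoly : ¬ ∃ p : ℝ[X], ∀ t, σ t = p.eval t) :
    ∃ φ : ContDiffBump (0 : ℝ),
      ContDiff ℝ ∞ (φ.normed volume ⋆[ContinuousLinearMap.lsmul ℝ ℝ, volume] σ) ∧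
      ∀ k, ∃ t, iteratedDeriv k
        (φ.normed volume ⋆[ContinuousLinearMap.lsmul ℝ ℝ, volume] σ) t ≠ 0 := by
  have hsm : ∀ φ : ContDiffBump (0 : ℝ),
      ContDiff ℝ ∞ (φ.normed volume ⋆[ContinuousLinearMap.lsmul ℝ ℝ, volume] σ) := fun φ =>
    φ.hasCompactSupport_normed.contDiff_convolution_left _ φ.contDiff_normed
      hL.continuous.locallyIntegrable
  by_contra! hcon
  refine hpoly ⟨C (σ 0) + X * C (σ 1 - σ 0), fun t => ?_⟩
  let φ : ℕ → ContDiffBump (0 : ℝ) := fun n =>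
    ⟨1 / ((n : ℝ) + 1) / 2, 1 / ((n : ℝ) + 1), by positivity, by
      have : (0 : ℝ) < 1 / ((n : ℝ) + 1) := by positivity
      linarith⟩
  have hφ : Tendsto (fun n => (φ n).rOut) atTop (𝓝 0) := tendsto_one_div_add_atTop_nhds_zero_nat
  have hlim := fun s => ContDiffBump.convolution_tendsto_right_of_continuous (μ := volume) hφ
    hL.continuous s
  -- The order k may depend on n; the Lipschitz bound still forces degree at most one. Interpolation
  -- at 0 and 1 is a form that survives pointwise limits.
  have haff := fun n s => (hcon (φ n) (hsm _)).elim fun k hk =>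
    affine_of_lipschitzWith_of_iteratedDeriv_eq_zero (lipschitzWith_mollify hL (φ n)) (hsm _) hk s
  have h2 := tendsto_nhds_unique ((hlim t).congr fun n => haff n t)
    ((hlim 0).add (((hlim 1).sub (hlim 0)).const_mul t))
  simpa using h2

end Affine

/-! ### Functionals annihilating ridge functions. -/

section Density

variable {d : ℕ} {X : Set (Vec d)}

/-- The ridge function `x ↦ τ(⟨w,x⟩ + b)` on `X`. -/
noncomputable def ridge (X : Set (Vec d)) (τ : C(ℝ, ℝ)) (θ : Vec d × ℝ) : C(X, ℝ) :=
  ⟨fun x => τ (inner ℝ θ.1 (x : Vec d) + θ.2), by fun_prop⟩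

@[simp] theorem ridge_apply (τ : C(ℝ, ℝ)) (θ : Vec d × ℝ) (x : X) :
    ridge X τ θ x = τ (inner ℝ θ.1 (x : Vec d) + θ.2) := rfl

theorem continuous_ridge (τ : C(ℝ, ℝ)) : Continuous (ridge X τ) :=
  ContinuousMap.continuous_of_continuous_uncurry _ <| by
    simp only [Function.uncurry_def, ridge_apply]
    fun_prop

/-- The linear form `⟨v, ·⟩` on `X`. -/
noncomputable def linForm (X : Set (Vec d)) (v : Vec d) : C(X, ℝ) :=
  ⟨fun x => inner ℝ v (x : Vec d), by fun_prop⟩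

@[simp] theorem linForm_apply (v : Vec d) (x : X) : linForm X v x = inner ℝ v (x : Vec d) := rfl

variable [CompactSpace X]

/-- A curve in `C(Y)` that is pointwise differentiable with a continuous derivative is
differentiable. -/
theorem hasDerivAt_of_forall_apply {Y : Type*} [TopologicalSpace Y] [CompactSpace Y]
    {F F' : ℝ → C(Y, ℝ)} (hF' : Continuous F')
    (h : ∀ y s, HasDerivAt (fun s => F s y) (F' s y) s) (s : ℝ) : HasDerivAt F (F' s) s := by
  -- The pointwise fundamental theorem of calculus lifts to C(Y), since evaluations commute with the
  -- Bochner integral; a primitive is then differentiable in norm.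
  have hFs : F = fun s => F 0 + ∫ r in (0 : ℝ)..s, F' r := by
    funext s
    ext y
    have h1 := (ContinuousMap.evalCLM ℝ y).intervalIntegral_comp_comm
      (hF'.intervalIntegrable (μ := volume) 0 s)
    have h2 := intervalIntegral.integral_eq_sub_of_hasDerivAt (fun r _ => h y r)
      (((ContinuousMap.evalCLM ℝ y).continuous.comp hF').intervalIntegrable 0 s)
    have h3 : (∫ r in (0 : ℝ)..s, F' r) y = ∫ r in (0 : ℝ)..s, F' r y := h1.symm
    rw [ContinuousMap.add_apply, h3]
    have h4 : (∫ r in (0 : ℝ)..s, F' r y) = F s y - F 0 y := h2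
    linarith
  rw [hFs]
  exact (intervalIntegral.integral_hasDerivAt_right (hF'.intervalIntegrable _ _)
    (hF'.stronglyMeasurableAtFilter _ _) hF'.continuousAt).const_add _

/-- A functional that kills all ridge functions with profile `σ` kills those whose profile is a
mollification of `σ`. -/
theorem ridge_mollify_eq_zero (ℓ : C(X, ℝ) →L[ℝ] ℝ) (σ τ : C(ℝ, ℝ))
    (hℓ : ∀ θ, ℓ (ridge X σ θ) = 0) (φ : ContDiffBump (0 : ℝ))
    (hτ : ∀ t, τ t = (φ.normed volume ⋆[ContinuousLinearMap.lsmul ℝ ℝ, volume] ⇑σ) t)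
    (θ : Vec d × ℝ) : ℓ (ridge X τ θ) = 0 := by
  have hc : Continuous fun u : ℝ => φ.normed volume u • ridge X σ (θ.1, θ.2 - u) :=
    φ.continuous_normed.smul ((continuous_ridge σ).comp (by fun_prop))
  have hi : Integrable (fun u : ℝ => φ.normed volume u • ridge X σ (θ.1, θ.2 - u)) :=
    hc.integrable_of_hasCompactSupport φ.hasCompactSupport_normed.smul_right
  -- Convolution in the profile is an average over translated biases.
  have h : ridge X τ θ = ∫ u, φ.normed volume u • ridge X σ (θ.1, θ.2 - u) := by
    ext x
    have h1 := (ContinuousMap.evalCLM ℝ x).integral_comp_comm hi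
    refine Eq.trans ?_ h1
    simp [hτ, convolution_def, add_sub_assoc]
  rw [h, ← ℓ.integral_comp_comm hi]
  simp [hℓ]

/-- A functional that kills all ridge functions with a smooth profile `τ` kills
`⟨v,x⟩^k τ^{(k)}(⟨w,x⟩ + b)`. -/
theorem linForm_pow_mul_ridge_eq_zero (ℓ : C(X, ℝ) →L[ℝ] ℝ) {τ : ℝ → ℝ} (hτ : ContDiff ℝ ∞ τ)
    (hℓ : ∀ θ, ℓ (ridge X ⟨τ, hτ.continuous⟩ θ) = 0) (v : Vec d) (k : ℕ) (θ : Vec d × ℝ) :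
    ℓ (linForm X v ^ k * ridge X ⟨iteratedDeriv k τ,
      hτ.continuous_iteratedDeriv k (mod_cast le_top)⟩ θ) = 0 := by
  induction k generalizing θ with
  | zero => simpa using hℓ θ
  | succ k ih =>
    have hcont : Continuous fun s : ℝ => linForm X v ^ (k + 1) * ridge X ⟨iteratedDeriv (k + 1) τ,
        hτ.continuous_iteratedDeriv (k + 1) (mod_cast le_top)⟩ (θ.1 + s • v, θ.2) :=
      continuous_const.mul ((continuous_ridge _).comp (by fun_prop))
    have hd := hasDerivAt_of_forall_apply (F := fun s : ℝ => linForm X v ^ k *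
        ridge X ⟨iteratedDeriv k τ,
          hτ.continuous_iteratedDeriv k (mod_cast le_top)⟩ (θ.1 + s • v, θ.2)) hcont
      (fun x s => by
        have hk : HasDerivAt (iteratedDeriv k τ)
            (iteratedDeriv (k + 1) τ (inner ℝ (θ.1 + s • v) (x : Vec d) + θ.2))
            (inner ℝ (θ.1 + s • v) (x : Vec d) + θ.2) := by
          rw [iteratedDeriv_succ]
          exact (hτ.differentiable_iteratedDeriv k (mod_cast ENat.natCast_lt_top k) _).hasDerivAt
        have hin : HasDerivAt (fun s : ℝ => inner ℝ (θ.1 + s • v) (x : Vec d) + θ.2)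
            (inner ℝ v (x : Vec d)) s := by
          simp only [inner_add_left, real_inner_smul_left]
          simpa using (((hasDerivAt_id s).mul_const (inner ℝ v (x : Vec d))).const_add
            (inner ℝ θ.1 (x : Vec d))).add_const θ.2
        have := (hk.comp s hin).const_mul (inner ℝ v (x : Vec d) ^ k)
        simp only [ContinuousMap.mul_apply, ContinuousMap.pow_apply, linForm_apply, ridge_apply,
          ContinuousMap.coe_mk]
        refine this.congr_deriv ?_
        ring) 0
    have hℓd := ℓ.hasFDerivAt.comp_hasDerivAt (0 : ℝ) hd
    have h0 : (⇑ℓ ∘ fun s : ℝ => linForm X v ^ k * ridge X ⟨iteratedDeriv k τ,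
        hτ.continuous_iteratedDeriv k (mod_cast le_top)⟩ (θ.1 + s • v, θ.2)) = fun _ => 0 :=
      funext fun s => ih _
    rw [h0] at hℓd
    have := hℓd.unique (hasDerivAt_const _ _)
    simpa using this

/-- A functional that kills the powers of all linear forms vanishes. -/
theorem eq_zero_of_linForm_pow_eq_zero (ℓ : C(X, ℝ) →L[ℝ] ℝ)
    (h : ∀ v k, ℓ (linForm X v ^ k) = 0) : ℓ = 0 := by
  have hexp : ∀ v, ℓ (NormedSpace.exp (linForm X v)) = 0 := fun v => by
    have hs := (NormedSpace.exp_series_hasSum_exp' (𝕂 := ℝ) (linForm X v)).mapL ℓ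
    simp only [map_smul, h, smul_zero] at hs
    exact hs.unique hasSum_zero
  have hev : ∀ (g : C(X, ℝ)) x, NormedSpace.exp g x = Real.exp (g x) := fun g x => by
    rw [Real.exp_eq_exp_ℝ]
    exact NormedSpace.map_exp (ContinuousMap.evalAlgHom ℝ ℝ x)
      (continuous_eval_const x) g
  -- Exponentials of linear forms are closed under products, so the algebra they generate is just
  -- their linear span, on which ℓ vanishes.
  let S : Submonoid C(X, ℝ) :=
    { carrier := Set.range fun v => NormedSpace.exp (linForm X v)
      one_mem' := ⟨0, by ext x; simp [hev]⟩
      mul_mem' := by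
        rintro _ _ ⟨v, rfl⟩ ⟨w, rfl⟩
        exact ⟨v + w, by ext x; simp [hev, inner_add_left, Real.exp_add]⟩ }
  have htop := ContinuousMap.subalgebra_topologicalClosure_eq_top_of_separatesPoints
    (Algebra.adjoin ℝ (S : Set C(X, ℝ))) (by
      intro x y hxy
      refine ⟨_, ⟨_, Algebra.subset_adjoin ⟨(x : Vec d) - y, rfl⟩, rfl⟩, ?_⟩
      simp only [hev, linForm_apply]
      refine fun he => hxy (Subtype.ext (sub_eq_zero.1 (inner_self_eq_zero (𝕜 := ℝ).1 ?_)))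
      rw [inner_sub_right]
      exact sub_eq_zero.2 (Real.exp_injective he))
  have hker : ∀ g ∈ Algebra.adjoin ℝ (S : Set C(X, ℝ)), ℓ g = 0 := by
    intro g hg
    rw [← Subalgebra.mem_toSubmodule, Algebra.adjoin_eq_span, Submonoid.closure_eq] at hg
    induction hg using Submodule.span_induction with
    | mem g hg => obtain ⟨v, rfl⟩ := hg; exact hexp v
    | zero => exact map_zero ℓ
    | add f g _ _ hf hg => rw [map_add, hf, hg, add_zero]
    | smul c g _ hg => rw [map_smul, hg, smul_zero]
  ext g
  have hg : g ∈ closure ((Algebra.adjoin ℝ (S : Set C(X, ℝ)) : Subalgebra ℝ C(X, ℝ)) :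
      Set C(X, ℝ)) := by
    rw [← Subalgebra.topologicalClosure_coe, htop]
    trivial
  exact closure_minimal (t := {g | ℓ g = 0}) hker (isClosed_eq ℓ.continuous continuous_const) hg

/-- Universal approximation, in dual form: a functional on `C(X)` that kills all ridge functions
with a Lipschitz non-polynomial profile vanishes. -/
theorem eq_zero_of_ridge_eq_zero {L : NNReal} {σ : ℝ → ℝ} (hL : LipschitzWith L σ)
    (hpoly : ¬ ∃ p : ℝ[X], ∀ t, σ t = p.eval t) (ℓ : C(X, ℝ) →L[ℝ] ℝ)
    (hℓ : ∀ θ, ℓ (ridge X ⟨σ, hL.continuous⟩ θ) = 0) : ℓ = 0 := by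
  obtain ⟨φ, hsm, hne⟩ := exists_mollify_iteratedDeriv_ne_zero hL hpoly
  refine eq_zero_of_linForm_pow_eq_zero ℓ fun v k => ?_
  obtain ⟨t, ht⟩ := hne k
  have h := linForm_pow_mul_ridge_eq_zero ℓ hsm
    (ridge_mollify_eq_zero ℓ _ ⟨_, hsm.continuous⟩ hℓ φ fun _ => rfl) v k (0, t)
  have he : linForm X v ^ k * ridge X ⟨_, hsm.continuous_iteratedDeriv k (mod_cast le_top)⟩ (0, t)
      = iteratedDeriv k (φ.normed volume ⋆[ContinuousLinearMap.lsmul ℝ ℝ, volume] σ) t •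
        linForm X v ^ k := by
    ext x
    simp [mul_comm]
  rw [he, map_smul, smul_eq_mul] at h
  exact (mul_eq_zero.1 h).resolve_left ht

end Density

/-! ### Continuity and density of infinite-width networks. -/

section InfiniteWidth

variable {d : ℕ} {X : Set (Vec d)} {σ : ℝ → ℝ} {L : NNReal} {μ : Measure (Vec d × ℝ)}

theorem memLp_norm_of_integrable_sq
    (hμ : Integrable (fun θ : Vec d × ℝ => ‖θ.1‖ ^ 2 + ‖θ.2‖ ^ 2) μ) :
    MemLp (fun θ : Vec d × ℝ => ‖θ‖) 2 μ := by
  rw [memLp_two_iff_integrable_sq (by fun_prop)]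
  refine hμ.mono' (by fun_prop) (Eventually.of_forall fun θ => ?_)
  rw [Real.norm_of_nonneg (by positivity), Prod.norm_def]
  rcases max_cases ‖θ.1‖ ‖θ.2‖ with ⟨h, -⟩ | ⟨h, -⟩ <;> rw [h] <;>
    nlinarith [sq_nonneg ‖θ.1‖, sq_nonneg ‖θ.2‖]

theorem abs_inner_add_le (θ : Vec d × ℝ) (x : Vec d) :
    |inner ℝ θ.1 x + θ.2| ≤ (‖x‖ + 1) * ‖θ‖ :=
  calc |inner ℝ θ.1 x + θ.2| ≤ |inner ℝ θ.1 x| + |θ.2| := abs_add_le _ _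
    _ ≤ ‖θ.1‖ * ‖x‖ + ‖θ.2‖ := add_le_add (abs_real_inner_le_norm _ _) le_rfl
    _ ≤ ‖θ‖ * ‖x‖ + ‖θ‖ := by gcongr; exacts [norm_fst_le θ, norm_snd_le θ]
    _ = (‖x‖ + 1) * ‖θ‖ := by ring

theorem abs_lipschitz_sub_le (hL : LipschitzWith L σ) (s t : ℝ) : |σ s - σ t| ≤ L * |s - t| :=
  hL.dist_le_mul s t

theorem abs_lipschitz_le (hL : LipschitzWith L σ) (s : ℝ) : |σ s| ≤ |σ 0| + L * |s| := by
  have h := abs_lipschitz_sub_le hL s 0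
  have h' := abs_sub_abs_le_abs_sub (σ s) (σ 0)
  rw [sub_zero] at h
  linarith

theorem continuous_activation (hL : LipschitzWith L σ) (x : Vec d) :
    Continuous fun θ : Vec d × ℝ => σ (inner ℝ θ.1 x + θ.2) :=
  hL.continuous.comp (by fun_prop)

/-- If `μ` is a finite measure with second moments, the networks are absolutely convergent. -/
theorem integrable_mul_activation [IsFiniteMeasure μ] (hL : LipschitzWith L σ)
    (hμ : MemLp (fun θ : Vec d × ℝ => ‖θ‖) 2 μ) {a : Vec d × ℝ → ℝ} (ha : MemLp a 2 μ) (x : Vec d) :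
    Integrable (fun θ => a θ * σ (inner ℝ θ.1 x + θ.2)) μ := by
  refine ha.integrable_mul (q := 2) ?_
  -- Finiteness of μ is what puts the constant |σ 0| in L².
  refine ((memLp_const |σ 0|).add (hμ.const_mul (L * (‖x‖ + 1)))).mono'
    (continuous_activation hL x).aestronglyMeasurable (Eventually.of_forall fun θ => ?_)
  refine (abs_lipschitz_le hL _).trans ?_
  simp only [Pi.add_apply]
  rw [mul_assoc]
  gcongr
  exact abs_inner_add_le θ x

/-- Such a function is Lipschitz with constant L ∫ |a| ‖θ‖ dμ, finite by Cauchy–Schwarz. Differences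
in x cancel σ(0), so μ may be infinite. -/
theorem continuous_of_mem_infiniteWidthNetworks (hL : LipschitzWith L σ)
    (hμ : MemLp (fun θ : Vec d × ℝ => ‖θ‖) 2 μ) {f : X → ℝ} (hf : f ∈ infiniteWidthNetworks σ μ X) :
    Continuous f := by
  obtain ⟨a, ha, hf⟩ := hf
  have hi : Integrable (fun θ : Vec d × ℝ => |a θ| * ‖θ‖) μ := ha.abs.integrable_mul hμ
  refine (LipschitzWith.of_dist_le_mul (K := (L * ∫ θ, |a θ| * ‖θ‖ ∂μ).toNNReal)
    fun x y => ?_).continuous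
  rw [Real.coe_toNNReal _ (mul_nonneg L.coe_nonneg (integral_nonneg fun θ => by positivity)),
    (hf x).2, (hf y).2, dist_eq_norm, ← integral_sub (hf x).1 (hf y).1]
  calc ‖∫ θ, a θ * σ (inner ℝ θ.1 (x : Vec d) + θ.2) - a θ * σ (inner ℝ θ.1 (y : Vec d) + θ.2) ∂μ‖
      ≤ ∫ θ, (|a θ| * ‖θ‖) * (L * dist x y) ∂μ := by
        refine norm_integral_le_of_norm_le (hi.mul_const _) (Eventually.of_forall fun θ => ?_)
        rw [← mul_sub, norm_mul, Real.norm_eq_abs, mul_assoc]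
        refine mul_le_mul_of_nonneg_left ((abs_lipschitz_sub_le hL _ _).trans ?_) (abs_nonneg _)
        rw [add_sub_add_right_eq_sub, ← inner_sub_right, mul_left_comm]
        refine mul_le_mul_of_nonneg_left ((abs_real_inner_le_norm _ _).trans ?_) L.coe_nonneg
        rw [Subtype.dist_eq, dist_eq_norm]
        gcongr
        exact norm_fst_le θ
    _ = L * (∫ θ, |a θ| * ‖θ‖ ∂μ) * dist x y := by rw [integral_mul_const]; ring

variable [CompactSpace X]

/-- The continuous functions realized by infinite-width networks, as a subspace of `C(X)`. -/
def infiniteWidthSubmodule (σ : ℝ → ℝ) (μ : Measure (Vec d × ℝ)) (X : Set (Vec d)) :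
    Submodule ℝ C(X, ℝ) where
  carrier := {g | ⇑g ∈ infiniteWidthNetworks σ μ X}
  zero_mem' := ⟨0, MemLp.zero, fun x => by simp⟩
  add_mem' := by
    rintro f g ⟨a, ha, hf⟩ ⟨b, hb, hg⟩
    refine ⟨a + b, ha.add hb, fun x => ?_⟩
    simp only [Pi.add_apply, add_mul, ContinuousMap.add_apply]
    exact ⟨(hf x).1.add (hg x).1, by rw [integral_add (hf x).1 (hg x).1, (hf x).2, (hg x).2]⟩
  smul_mem' := by
    rintro c f ⟨a, ha, hf⟩
    refine ⟨c • a, ha.const_smul c, fun x => ?_⟩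
    simp only [Pi.smul_apply, smul_eq_mul, mul_assoc, ContinuousMap.smul_apply]
    exact ⟨(hf x).1.const_mul c, by rw [integral_const_mul, (hf x).2]⟩

/-- By Chebyshev, finite second moments allow infinite mass only near the origin, and this ball
stays away from it. -/
theorem measure_ball_lt_top (hμ : MemLp (fun θ : Vec d × ℝ => ‖θ‖) 2 μ) {θ₀ : Vec d × ℝ} {ε : ℝ}
    (hε : ε < ‖θ₀‖) : μ (Metric.ball θ₀ ε) < ⊤ := by
  refine (measure_mono fun θ hθ => ?_).trans_lt
    (hμ.meas_ge_lt_top (by simp) (by simp) (ε := (‖θ₀‖ - ε).toNNReal) (by simpa using hε))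
  rw [Metric.mem_ball, dist_comm, dist_eq_norm] at hθ
  have := norm_sub_norm_le θ₀ θ
  simp only [Set.mem_ofPred_eq]
  rw [← NNReal.coe_le_coe, Real.coe_toNNReal _ (by linarith), coe_nnnorm, norm_norm]
  linarith

theorem integrableOn_of_abs_sub_le {α : Type*} [TopologicalSpace α] [MeasurableSpace α]
    [OpensMeasurableSpace α] {ν : Measure α} {B : Set α} (hB : MeasurableSet B) (hfin : ν B < ⊤)
    {g : α → ℝ} (hg : Continuous g) {c δ : ℝ} (h : ∀ y ∈ B, |g y - c| ≤ δ) :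
    IntegrableOn g B ν := by
  refine Measure.integrableOn_of_bounded (M := |c| + δ) hfin.ne
    hg.measurable.aestronglyMeasurable ?_
  filter_upwards [ae_restrict_mem hB] with y hy
  have h2 := abs_sub_abs_le_abs_sub (g y) c
  rw [Real.norm_eq_abs]
  linarith [h y hy]

theorem abs_inv_mul_setIntegral_sub_le {α : Type*} [MeasurableSpace α] {ν : Measure α} {B : Set α}
    (hpos : 0 < ν.real B) (hfin : ν B < ⊤) {g : α → ℝ} (hg : IntegrableOn g B ν) {c δ : ℝ}
    (h : ∀ y ∈ B, |g y - c| ≤ δ) : |(ν.real B)⁻¹ * ∫ y in B, g y ∂ν - c| ≤ δ := by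
  have hfin' : Fact (ν B < ⊤) := ⟨hfin⟩
  have hc : c = (ν.real B)⁻¹ * ∫ _ in B, c ∂ν := by
    rw [setIntegral_const, smul_eq_mul, inv_mul_cancel_left₀ hpos.ne']
  have hle := norm_setIntegral_le_of_norm_le_const (f := fun y => g y - c) hfin h
  rw [integral_sub hg (integrable_const _), Real.norm_eq_abs] at hle
  rw [hc]
  rwa [← mul_sub, abs_mul, abs_of_pos (inv_pos.2 hpos), inv_mul_le_iff₀ hpos, mul_comm]

/-- Ridge functions with nonzero parameters are limits of infinite-width networks. -/
theorem ridge_mem_closure [μ.IsOpenPosMeasure] (hL : LipschitzWith L σ)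
    (hμ : MemLp (fun θ : Vec d × ℝ => ‖θ‖) 2 μ) {θ₀ : Vec d × ℝ} (hθ₀ : θ₀ ≠ 0) :
    ridge X ⟨σ, hL.continuous⟩ θ₀ ∈ closure (infiniteWidthSubmodule σ μ X : Set C(X, ℝ)) := by
  rw [Metric.mem_closure_iff]
  intro δ hδ
  obtain ⟨η, hη, hball⟩ := Metric.continuousAt_iff.1
    ((continuous_ridge (X := X) ⟨σ, hL.continuous⟩).continuousAt (x := θ₀)) (δ / 2) (by positivity)
  obtain ⟨ε, hε, hεlt⟩ := exists_between (lt_min hη (norm_pos_iff.2 hθ₀))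
  set B := Metric.ball θ₀ ε with hB
  have hfin : μ B < ⊤ := measure_ball_lt_top hμ (hεlt.trans_le (min_le_right _ _))
  have hpos : 0 < μ.real B := ENNReal.toReal_pos (Metric.measure_ball_pos μ θ₀ hε).ne' hfin.ne
  have hmeas : MeasurableSet B := Metric.isOpen_ball.measurableSet
  -- This weight averages σ(⟨w,x⟩ + b) over B. Continuity of `ridge` into C(X) makes the error
  -- uniform in x.
  set a : Vec d × ℝ → ℝ := B.indicator fun _ => (μ.real B)⁻¹ with ha
  have ha2 : MemLp a 2 μ := memLp_indicator_const 2 hmeas _ (Or.inr hfin.ne)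
  have hrw : ∀ x : X, (fun θ => a θ * σ (inner ℝ θ.1 (x : Vec d) + θ.2)) =
      B.indicator fun θ => (μ.real B)⁻¹ * σ (inner ℝ θ.1 (x : Vec d) + θ.2) := fun x => by
    funext θ
    by_cases h : θ ∈ B <;> simp [ha, h]
  have hdist : ∀ θ ∈ B, ∀ x : X,
      |σ (inner ℝ θ.1 (x : Vec d) + θ.2) - σ (inner ℝ θ₀.1 (x : Vec d) + θ₀.2)| ≤ δ / 2 := by
    intro θ hθ x
    have h1 := hball ((Metric.mem_ball.1 hθ).trans (hεlt.trans_le (min_le_left _ _)))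
    exact ((ContinuousMap.dist_apply_le_dist x).trans h1.le)
  have hint : ∀ x : X, IntegrableOn (fun θ => σ (inner ℝ θ.1 (x : Vec d) + θ.2)) B μ := fun x =>
    integrableOn_of_abs_sub_le hmeas hfin (continuous_activation hL x.1) fun θ hθ => hdist θ hθ x
  have hf : (fun x : X => ∫ θ, a θ * σ (inner ℝ θ.1 (x : Vec d) + θ.2) ∂μ) ∈
      infiniteWidthNetworks σ μ X := by
    refine ⟨a, ha2, fun x => ⟨?_, rfl⟩⟩
    rw [hrw, integrable_indicator_iff hmeas]
    exact (hint x).const_mul _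
  let F : C(X, ℝ) := ⟨_, continuous_of_mem_infiniteWidthNetworks hL hμ hf⟩
  have hF : F ∈ infiniteWidthSubmodule σ μ X := hf
  refine ⟨F, hF, ?_⟩
  refine lt_of_le_of_lt ?_ (half_lt_self hδ)
  rw [ContinuousMap.dist_le (by positivity)]
  intro x
  have hFx : F x = ∫ θ, a θ * σ (inner ℝ θ.1 (x : Vec d) + θ.2) ∂μ := rfl
  rw [hFx, ridge_apply, ContinuousMap.coe_mk, hrw, integral_indicator hmeas, integral_const_mul,
    dist_comm, Real.dist_eq]
  exact abs_inv_mul_setIntegral_sub_le hpos hfin (hint x) fun θ hθ => hdist θ hθ x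

/-- Infinite-width networks are dense in `C(X)`. -/
theorem dense_infiniteWidthNetworks [μ.IsOpenPosMeasure] (hL : LipschitzWith L σ)
    (hpoly : ¬ ∃ p : ℝ[X], ∀ t, σ t = p.eval t) (hμ : MemLp (fun θ : Vec d × ℝ => ‖θ‖) 2 μ) :
    Dense {g : C(X, ℝ) | ⇑g ∈ infiniteWidthNetworks σ μ X} := by
  set V := (infiniteWidthSubmodule σ μ X).topologicalClosure with hV
  -- Balls around θ = 0 may have infinite mass; that parameter is reached as a limit of nonzero
  -- ones.
  have hridge : ∀ θ, ridge X ⟨σ, hL.continuous⟩ θ ∈ V := fun θ =>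
    closure_minimal (s := {0}ᶜ) (t := {θ | ridge X ⟨σ, hL.continuous⟩ θ ∈ V})
      (fun θ hθ => ridge_mem_closure hL hμ hθ)
      ((Submodule.isClosed_topologicalClosure _).preimage (continuous_ridge _))
      (dense_compl_singleton (0 : Vec d × ℝ) θ)
  intro g
  change g ∈ V
  by_contra hg
  obtain ⟨ℓ, u, hu, hgu⟩ := geometric_hahn_banach_closed_point V.convex
    (Submodule.isClosed_topologicalClosure _) hg
  have h0 : ∀ f ∈ V, ℓ f = 0 := fun f hf => by
    by_contra hne
    -- This multiple of f has ℓ-value u + 1, against the bound u on the subspace.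
    have h := hu _ (V.smul_mem ((u + 1) / ℓ f) hf)
    rw [map_smul, smul_eq_mul, div_mul_cancel₀ _ hne] at h
    linarith
  have hℓ := eq_zero_of_ridge_eq_zero hL hpoly ℓ fun θ => h0 _ (hridge θ)
  have h1 := hu 0 V.zero_mem
  rw [map_zero] at h1
  rw [hℓ] at hgu
  exact lt_asymm h1 hgu

end InfiniteWidth

/-! ### Gradients of the finite network. -/

section Network

variable {m d : ℕ} {σ : ℝ → ℝ} {L : NNReal}

/-- The argument `⟨w_ℓ,x⟩ + b_ℓ` of the activation, as a functional of the parameters. -/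
noncomputable def preact (m : ℕ) (x : Vec d) (l : Fin m) : Param m d →L[ℝ] ℝ :=
  ∑ i, x i • EuclideanSpace.proj (Sum.inr (Sum.inl (l, i))) +
    EuclideanSpace.proj (Sum.inr (Sum.inr (Sum.inl l)))

theorem preact_apply (x : Vec d) (l : Fin m) (θ : Param m d) :
    preact m x l θ = ∑ i, x i * θ (Sum.inr (Sum.inl (l, i))) +
      θ (Sum.inr (Sum.inr (Sum.inl l))) := by
  simp [preact]

theorem inner_innerWeight_add (x : Vec d) (l : Fin m) (θ : Param m d) :
    inner ℝ (innerWeight θ l) x + innerBias θ l = preact m x l θ := by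
  rw [preact_apply, PiLp.inner_apply]
  simp [innerWeight, innerBias]

theorem network_eq (x : Vec d) (θ : Param m d) :
    network σ θ x = (1 / Real.sqrt m) * ∑ l, θ (Sum.inl l) * σ (preact m x l θ) +
      θ (Sum.inr (Sum.inr (Sum.inr ()))) := by
  simp only [network, inner_innerWeight_add]
  rfl

theorem continuous_network (hσ : Continuous σ) :
    Continuous fun p : Vec d × Param m d => network σ p.2 p.1 := by
  simp only [network_eq, preact_apply]
  fun_prop

theorem differentiableAt_network (x : Vec d) (θ : Param m d)
    (h : ∀ l, DifferentiableAt ℝ σ (preact m x l θ)) :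
    DifferentiableAt ℝ (fun η : Param m d => network σ η x) θ := by
  simp only [network_eq]
  have hp : ∀ i : ParamIdx m d, DifferentiableAt ℝ (fun η : Param m d => η i) θ := fun i =>
    (EuclideanSpace.proj i : Param m d →L[ℝ] ℝ).differentiableAt
  have hl : ∀ l, DifferentiableAt ℝ (fun η => σ (preact m x l η)) θ := fun l =>
    (h l).comp θ (preact m x l).differentiableAt
  exact ((DifferentiableAt.fun_sum fun l _ => (hp (Sum.inl l)).fun_mul (hl l)).const_mul _).fun_add
    (hp _)

/-- The partial derivative of the network in an outer weight. -/
theorem gradient_network_inl (x : Vec d) (θ : Param m d)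
    (h : DifferentiableAt ℝ (fun η : Param m d => network σ η x) θ) (l : Fin m) :
    gradient (fun η : Param m d => network σ η x) θ (Sum.inl l) =
      (1 / Real.sqrt m) * σ (preact m x l θ) := by
  set e : Param m d := EuclideanSpace.single (Sum.inl l) (1 : ℝ) with he
  have h1 : gradient (fun η : Param m d => network σ η x) θ (Sum.inl l) =
      fderiv ℝ (fun η : Param m d => network σ η x) θ e := by
    rw [← inner_gradient_left, he, EuclideanSpace.inner_single_right]
    simp
  have hpre : ∀ l', preact m x l' e = 0 := fun l' => by simp [preact_apply, he]
  -- Along an outer weight the preactivations are fixed and the network is affine.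
  have h2 : HasLineDerivAt ℝ (fun η : Param m d => network σ η x)
      ((1 / Real.sqrt m) * σ (preact m x l θ)) θ e := by
    have hline : ∀ t : ℝ, network σ (θ + t • e) x =
        network σ θ x + t * ((1 / Real.sqrt m) * σ (preact m x l θ)) := fun t => by
      have hl : ∀ l', e (Sum.inl l') = if l' = l then 1 else 0 := fun l' => by simp [he]
      have hb : e (Sum.inr (Sum.inr (Sum.inr ()))) = 0 := by simp [he]
      simp only [network_eq, map_add, map_smul, hpre, add_zero, PiLp.add_apply,
        PiLp.smul_apply, add_mul, Finset.sum_add_distrib, hl, hb, smul_eq_mul, mul_ite, mul_one,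
        mul_zero, ite_mul, zero_mul, Finset.sum_ite_eq', Finset.mem_univ, if_true]
      ring
    unfold HasLineDerivAt
    simp only [hline]
    simpa using ((hasDerivAt_id (0 : ℝ)).mul_const
      ((1 / Real.sqrt m) * σ (preact m x l θ))).const_add (network σ θ x)
  rw [h1, ← h.lineDeriv_eq_fderiv, h2.lineDeriv]

/-- A square-integrable majorant of the gradients of the networks with inputs of norm `≤ R`. -/
noncomputable def gradBound (σ : ℝ → ℝ) (L : NNReal) (R : ℝ) (θ : Param m d) : ℝ :=
  ∑ l, ((|σ 0| + L * (∑ i, R * |θ (Sum.inr (Sum.inl (l, i)))| +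
      |θ (Sum.inr (Sum.inr (Sum.inl l)))|) + 1) +
    |θ (Sum.inl l)| * (L * (∑ _i : Fin d, R + 1))) + 1

theorem abs_preact_le {R : ℝ} {x : Vec d} (hx : ‖x‖ ≤ R) (l : Fin m) (θ : Param m d) :
    |preact m x l θ| ≤ ∑ i, R * |θ (Sum.inr (Sum.inl (l, i)))| +
      |θ (Sum.inr (Sum.inr (Sum.inl l)))| := by
  rw [preact_apply]
  refine (abs_add_le _ _).trans (add_le_add_left ((Finset.abs_sum_le_sum_abs _ _).trans
    (Finset.sum_le_sum fun i _ => ?_)) _)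
  rw [abs_mul]
  gcongr
  exact (PiLp.norm_apply_le x i).trans hx

theorem abs_preact_le_norm {R : ℝ} {x : Vec d} (hx : ‖x‖ ≤ R) (l : Fin m) (θ : Param m d) :
    |preact m x l θ| ≤ (∑ _i : Fin d, R + 1) * ‖θ‖ := by
  have hR : 0 ≤ R := (norm_nonneg x).trans hx
  have hc : ∀ i, |θ i| ≤ ‖θ‖ := PiLp.norm_apply_le θ
  refine (abs_preact_le hx l θ).trans ?_
  rw [add_mul, one_mul, Finset.sum_mul]
  gcongr <;> exact hc _

theorem gradBound_nonneg {R : ℝ} (hR : 0 ≤ R) (θ : Param m d) : 0 ≤ gradBound σ L R θ := by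
  unfold gradBound; positivity

theorem norm_gradient_network_le (hL : LipschitzWith L σ) {R : ℝ} {x : Vec d} (hx : ‖x‖ ≤ R)
    (θ : Param m d) :
    ‖gradient (fun η : Param m d => network σ η x) θ‖ ≤ gradBound σ L R θ := by
  have hR : 0 ≤ R := (norm_nonneg x).trans hx
  rw [gradient, LinearIsometryEquiv.norm_map]
  -- A Lipschitz estimate at θ suffices, even where the network is not differentiable and the
  -- gradient is 0 by default.
  refine norm_fderiv_le_of_lip' ℝ (gradBound_nonneg hR θ) ?_
  -- Source of the inner `+ 1` in `gradBound`; its final `+ 1` is the derivative in b₀.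
  have hev : ∀ᶠ η : Param m d in 𝓝 θ, ∀ l, |σ (preact m x l η)| < |σ (preact m x l θ)| + 1 :=
    eventually_all.2 fun l =>
      ((hL.continuous.comp (preact m x l).continuous).abs.continuousAt (x := θ)).eventually_lt
        continuousAt_const (lt_add_one _)
  filter_upwards [hev] with η hη
  have hc : ∀ i, |η i - θ i| ≤ ‖η - θ‖ := PiLp.norm_apply_le (η - θ)
  have hterm : ∀ l, |η (Sum.inl l) * σ (preact m x l η) - θ (Sum.inl l) * σ (preact m x l θ)| ≤
      ((|σ 0| + L * (∑ i, R * |θ (Sum.inr (Sum.inl (l, i)))| +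
        |θ (Sum.inr (Sum.inr (Sum.inl l)))|) + 1) +
        |θ (Sum.inl l)| * (L * (∑ _i : Fin d, R + 1))) * ‖η - θ‖ := fun l => by
    have h1 : |σ (preact m x l η)| ≤ |σ 0| + L * (∑ i, R * |θ (Sum.inr (Sum.inl (l, i)))| +
        |θ (Sum.inr (Sum.inr (Sum.inl l)))|) + 1 := by
      refine (hη l).le.trans (add_le_add_left ((abs_lipschitz_le hL _).trans ?_) 1)
      gcongr
      exact abs_preact_le hx l θ
    have h2 : |σ (preact m x l η) - σ (preact m x l θ)| ≤
        L * ((∑ _i : Fin d, R + 1) * ‖η - θ‖) := by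
      refine (abs_lipschitz_sub_le hL _ _).trans ?_
      rw [← map_sub]
      gcongr
      exact abs_preact_le_norm hx l _
    have h3 : η (Sum.inl l) * σ (preact m x l η) - θ (Sum.inl l) * σ (preact m x l θ) =
        (η (Sum.inl l) - θ (Sum.inl l)) * σ (preact m x l η) +
        θ (Sum.inl l) * (σ (preact m x l η) - σ (preact m x l θ)) := by ring
    rw [h3]
    refine (abs_add_le _ _).trans ?_
    rw [abs_mul, abs_mul, add_mul]
    refine add_le_add ?_ ?_
    · rw [mul_comm]
      exact mul_le_mul h1 (hc _) (abs_nonneg _) (by positivity)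
    · rw [mul_assoc, mul_assoc]
      gcongr
  have hsq : |1 / Real.sqrt m| ≤ 1 := by
    rw [abs_of_nonneg (by positivity)]
    rcases Nat.eq_zero_or_pos m with rfl | hm
    · simp
    · rw [div_le_one (by positivity)]
      exact Real.one_le_sqrt.2 (mod_cast hm)
  rw [network_eq, network_eq, add_sub_add_comm, ← mul_sub, ← Finset.sum_sub_distrib, gradBound,
    add_mul, one_mul, Finset.sum_mul]
  refine (norm_add_le _ _).trans (add_le_add ?_ (hc _))
  rw [norm_mul]
  refine (mul_le_of_le_one_left (norm_nonneg _) hsq).trans ?_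
  exact (norm_sum_le _ _).trans (Finset.sum_le_sum fun l _ => hterm l)

theorem measurable_gradient_network {X : Set (Vec d)} [CompactSpace X] (hσ : Continuous σ) :
    Measurable fun p : X × Param m d =>
      gradient (fun η : Param m d => network σ η (p.1 : Vec d)) p.2 := by
  have hc : Continuous (Function.uncurry fun (x : X) (η : Param m d) =>
      network σ η (x : Vec d)) :=
    (continuous_network hσ).comp (f := fun p : X × Param m d => ((p.1 : Vec d), p.2)) (by fun_prop)
  exact (InnerProductSpace.toDual ℝ (Param m d)).symm.continuous.measurable.comp
    (measurable_fderiv_with_param ℝ hc)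

end Network

/-! ### Almost sure properties of the initialization. -/

section Init

variable {m d : ℕ} {σ : ℝ → ℝ} {L : NNReal} {A B : Measure ℝ}

instance [IsProbabilityMeasure A] [IsProbabilityMeasure B] (i : ParamIdx m d) :
    IsProbabilityMeasure (paramLaw A B i) := by
  rcases i with _ | _ | _ | _ <;> unfold paramLaw <;> infer_instance

variable [IsProbabilityMeasure A] [IsProbabilityMeasure B]

instance : IsProbabilityMeasure (gaussianInit m d A B) :=
  Measure.isProbabilityMeasure_map (by fun_prop)

theorem measurePreserving_apply_gaussianInit (i : ParamIdx m d) :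
    MeasurePreserving (fun θ : Param m d => θ i) (gaussianInit m d A B) (paramLaw A B i) := by
  refine ⟨by fun_prop, ?_⟩
  rw [gaussianInit, Measure.map_map (by fun_prop) (by fun_prop)]
  exact (measurePreserving_eval (paramLaw (m := m) (d := d) A B) i).map_eq

/-- The bound is affine in the absolute values of the coordinates, so second moments of each
coordinate are enough. -/
theorem memLp_gradBound (hA : MemLp id 2 A) (σ : ℝ → ℝ) (L : NNReal) (R : ℝ) :
    MemLp (gradBound (m := m) (d := d) σ L R) 2 (gaussianInit m d A B) := by
  have hcoord : ∀ i : ParamIdx m d, MemLp id 2 (paramLaw A B i) →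
      MemLp (fun θ : Param m d => |θ i|) 2 (gaussianInit m d A B) := fun i hi =>
    (hi.comp_measurePreserving (measurePreserving_apply_gaussianInit i)).abs
  have hg : MemLp id 2 (gaussianReal 0 1) := memLp_id_gaussianReal' 2 (by simp)
  have hW : ∀ l : Fin m, MemLp (fun θ : Param m d =>
      L * (∑ i, R * |θ (Sum.inr (Sum.inl (l, i)))| + |θ (Sum.inr (Sum.inr (Sum.inl l)))|)) 2
      (gaussianInit m d A B) := fun l =>
    ((memLp_finsetSum Finset.univ fun i _ => (hcoord (Sum.inr (Sum.inl (l, i))) hg).const_mul R).add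
      (hcoord (Sum.inr (Sum.inr (Sum.inl l))) hg)).const_mul (L : ℝ)
  have hl : ∀ l : Fin m, MemLp (fun θ : Param m d => (|σ 0| +
      L * (∑ i, R * |θ (Sum.inr (Sum.inl (l, i)))| + |θ (Sum.inr (Sum.inr (Sum.inl l)))|) + 1) +
      |θ (Sum.inl l)| * (L * (∑ _i : Fin d, R + 1))) 2 (gaussianInit m d A B) := fun l =>
    (((memLp_const |σ 0|).add (hW l)).add (memLp_const 1)).add
      ((hcoord (Sum.inl l) hA).mul_const _)
  exact (memLp_finsetSum Finset.univ fun l _ => hl l).add (memLp_const 1)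

/-- If one coordinate has an absolutely continuous law, then adding to it a function of the other
coordinates almost surely avoids a given null set. -/
theorem ae_pi_add_notMem {ι : Type*} [Fintype ι] [DecidableEq ι] (μ : ι → Measure ℝ)
    [∀ i, SigmaFinite (μ i)] (i : ι) (hi : μ i ≪ volume) {g : (ι → ℝ) → ℝ} (hg : Measurable g)
    (hgi : ∀ θ t, g (Function.update θ i t) = g θ) {N : Set ℝ} (hN : MeasurableSet N)
    (hN0 : volume N = 0) : ∀ᵐ θ ∂Measure.pi μ, g θ + θ i ∉ N := by
  have hmeas : MeasurableSet {θ : ι → ℝ | g θ + θ i ∈ N} := by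
    have : Measurable fun θ : ι → ℝ => g θ + θ i := by fun_prop
    exact this hN
  rw [ae_iff]
  simp only [not_not]
  -- Integrate over coordinate i first: with the others fixed, the event is a translate of N.
  rw [← lintegral_indicator_one hmeas, lintegral_eq_lmarginal_univ (0 : ι → ℝ),
    lmarginal_erase' _ (measurable_one.indicator hmeas) (Finset.mem_univ i)]
  have h0 : ∀ θ : ι → ℝ, ∫⁻ t, {θ : ι → ℝ | g θ + θ i ∈ N}.indicator 1
      (Function.update θ i t) ∂μ i = 0 := fun θ => by
    have hpre : (fun t => {θ : ι → ℝ | g θ + θ i ∈ N}.indicator (1 : (ι → ℝ) → ENNReal)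
        (Function.update θ i t)) = ((g θ + ·) ⁻¹' N).indicator 1 := by
      funext t
      have hiff : Function.update θ i t ∈ {θ : ι → ℝ | g θ + θ i ∈ N} ↔
          t ∈ (g θ + ·) ⁻¹' N := by simp [hgi]
      by_cases ht : t ∈ (g θ + ·) ⁻¹' N
      · rw [Set.indicator_of_mem ht, Set.indicator_of_mem (hiff.2 ht)]; rfl
      · rw [Set.indicator_of_notMem ht, Set.indicator_of_notMem (mt hiff.1 ht)]
    rw [hpre, lintegral_indicator_one (measurable_const_add _ hN)]
    exact hi (by rw [measure_preimage_add, hN0])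
  simp only [h0]
  simp [lmarginal]

/-- By Rademacher, σ fails to be differentiable only on a null set, which the Gaussian bias b_ℓ
makes the preactivation avoid, even at x = 0. -/
theorem ae_differentiableAt_preact (hL : LipschitzWith L σ) (x : Vec d) (l : Fin m) :
    ∀ᵐ θ ∂(gaussianInit m d A B), DifferentiableAt ℝ σ (preact m x l θ) := by
  have hms := measurableSet_of_differentiableAt ℝ σ
  have hset : MeasurableSet {θ : Param m d | DifferentiableAt ℝ σ (preact m x l θ)} :=
    (preact m x l).continuous.measurable hms
  rw [gaussianInit, ae_map_iff (by fun_prop) hset]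
  have hac : paramLaw (m := m) (d := d) A B (Sum.inr (Sum.inr (Sum.inl l))) ≪ volume :=
    gaussianReal_absolutelyContinuous 0 one_ne_zero
  have h := ae_pi_add_notMem (paramLaw (m := m) (d := d) A B) _ hac
    (g := fun θ => ∑ i, x i * θ (Sum.inr (Sum.inl (l, i)))) (by fun_prop)
    (fun θ t => by simp [Function.update]) hms.compl (ae_iff.1 hL.ae_differentiableAt_real)
  filter_upwards [h] with θ hθ
  rw [preact_apply]
  simpa using hθ

theorem ae_differentiableAt_network (hL : LipschitzWith L σ) (x : Vec d) :
    ∀ᵐ θ ∂(gaussianInit m d A B),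
      DifferentiableAt ℝ (fun η : Param m d => network σ η x) θ := by
  filter_upwards [ae_all_iff.2 fun l => ae_differentiableAt_preact hL x l] with θ hθ
  exact differentiableAt_network x θ hθ

/-- A continuous function of the inner weights and bias of one neuron that vanishes almost surely
at the initialization vanishes identically. -/
theorem eq_zero_of_ae_innerWeight {h : Vec d × ℝ → ℝ} (hc : Continuous h) (l : Fin m)
    (h0 : ∀ᵐ θ ∂(gaussianInit m d A B), h (innerWeight θ l, innerBias θ l) = 0)
    (p : Vec d × ℝ) : h p = 0 := by
  by_contra hp
  have hcont : Continuous fun θ : Param m d => (innerWeight θ l, innerBias θ l) := by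
    unfold innerWeight innerBias
    fun_prop
  set U : Set (ParamIdx m d → ℝ) :=
    {θ | h (innerWeight (WithLp.toLp 2 θ) l, innerBias (WithLp.toLp 2 θ) l) ≠ 0} with hU
  have hUo : IsOpen U := isOpen_ne_fun ((hc.comp hcont).comp (PiLp.continuous_toLp 2 _))
    continuous_const
  let θ₀ : ParamIdx m d → ℝ := Sum.elim 0 (Sum.elim (fun i => p.1 i.2) (Sum.elim (fun _ => p.2) 0))
  have hθ₀ : θ₀ ∈ U := hp
  obtain ⟨u, hu, hsub⟩ := isOpen_pi_iff'.1 hUo θ₀ hθ₀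
  -- The laws A and B may miss open sets, so the a and b₀ coordinates, on which U does not depend,
  -- are left free.
  let v : ParamIdx m d → Set ℝ := Sum.elim (fun _ => Set.univ)
    (Sum.elim (fun j => u (Sum.inr (Sum.inl j)))
      (Sum.elim (fun j => u (Sum.inr (Sum.inr (Sum.inl j)))) fun _ => Set.univ))
  have hvU : Set.pi Set.univ v ⊆ U := fun θ hθ => by
    have hmem : (Sum.elim (fun j => θ₀ (Sum.inl j)) (Sum.elim (fun j => θ (Sum.inr (Sum.inl j)))
        (Sum.elim (fun j => θ (Sum.inr (Sum.inr (Sum.inl j))))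
          fun j => θ₀ (Sum.inr (Sum.inr (Sum.inr j))))) : ParamIdx m d → ℝ) ∈ U := by
      refine hsub fun i _ => ?_
      rcases i with i | i | i | i
      · exact (hu _).2
      · exact hθ (Sum.inr (Sum.inl i)) trivial
      · exact hθ (Sum.inr (Sum.inr (Sum.inl i))) trivial
      · exact (hu _).2
    exact hmem
  have hgauss : ∀ i, 0 < gaussianReal 0 1 (u i) := fun i =>
    pos_iff_ne_zero.2 fun h => (hu i).1.measure_ne_zero volume ⟨_, (hu i).2⟩
      (gaussianReal_absolutelyContinuous' 0 one_ne_zero h)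
  have hvpos : 0 < Measure.pi (paramLaw (m := m) (d := d) A B) (Set.pi Set.univ v) := by
    rw [Measure.pi_pi, pos_iff_ne_zero, Finset.prod_ne_zero_iff]
    rintro (i | i | i | i) -
    · exact (measure_univ (μ := A)).trans_ne one_ne_zero
    · exact (hgauss _).ne'
    · exact (hgauss _).ne'
    · exact (measure_univ (μ := B)).trans_ne one_ne_zero
  refine (hvpos.trans_le (measure_mono hvU)).ne' ?_
  exact ae_iff.1 (ae_of_ae_map (by fun_prop) h0)

end Init

/-! ### Strict positivity of random feature kernels. -/

section FeatureKernel

theorem abs_inner_feature_le {Y Ω H : Type*} [NormedAddCommGroup H] [InnerProductSpace ℝ H]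
    {G : Y → Ω → H} {M : Ω → ℝ} (hM : ∀ y z, ‖G y z‖ ≤ M z) (x y : Y) (z : Ω) :
    |inner ℝ (G x z) (G y z)| ≤ M z ^ 2 := by
  refine (abs_real_inner_le_norm _ _).trans ?_
  rw [sq]
  exact mul_le_mul (hM x z) (hM y z) (norm_nonneg _) ((norm_nonneg _).trans (hM x z))

variable {Y Ω H : Type*} [MeasurableSpace Y] [MeasurableSpace Ω] {P : Measure Ω}
  [NormedAddCommGroup H] [InnerProductSpace ℝ H] [MeasurableSpace H] [BorelSpace H]
  [SecondCountableTopology H] {G : Y → Ω → H} {M : Ω → ℝ}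

theorem measurable_inner_feature (hG : Measurable (Function.uncurry G)) :
    Measurable fun p : (Y × Y) × Ω => (inner ℝ (G p.1.1 p.2) (G p.1.2 p.2) : ℝ) :=
  (hG.comp (f := fun p : (Y × Y) × Ω => (p.1.1, p.2)) (by fun_prop)).inner
    (hG.comp (f := fun p : (Y × Y) × Ω => (p.1.2, p.2)) (by fun_prop))

theorem integrable_inner_feature (hG : Measurable (Function.uncurry G))
    (hM : ∀ y z, ‖G y z‖ ≤ M z) (hM2 : MemLp M 2 P) (x y : Y) :
    Integrable (fun z => (inner ℝ (G x z) (G y z) : ℝ)) P :=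
  hM2.integrable_sq.mono'
    ((measurable_inner_feature hG).comp (measurable_prodMk_left (x := (x, y)))).aestronglyMeasurable
    (Eventually.of_forall fun z => abs_inner_feature_le hM x y z)

theorem integral_sq_eq_of_feature [CompleteSpace H] {ρ : Measure Y} [SFinite ρ]
    (hG : Measurable (Function.uncurry G)) (hM : ∀ y z, ‖G y z‖ ≤ M z) {f : Y → ℝ}
    (hf : Integrable f ρ) (z : Ω) :
    ‖∫ x, f x • G x z ∂ρ‖ ^ 2 =
      ∫ p : Y × Y, f p.1 * f p.2 * inner ℝ (G p.1 z) (G p.2 z) ∂(ρ.prod ρ) := by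
  have hGz : Measurable fun x => G x z := hG.comp (measurable_prodMk_right (y := z))
  have hi : Integrable (fun x => f x • G x z) ρ :=
    (hf.norm.mul_const (M z)).mono' (hf.aestronglyMeasurable.smul hGz.aestronglyMeasurable)
      (Eventually.of_forall fun x => by rw [norm_smul]; gcongr; exact hM x z)
  have hint : Integrable (fun p : Y × Y => f p.1 * f p.2 * inner ℝ (G p.1 z) (G p.2 z))
      (ρ.prod ρ) := by
    refine ((hf.mul_prod hf).norm.mul_const (M z ^ 2)).mono'
      ((hf.mul_prod hf).aestronglyMeasurable.mul ((measurable_inner_feature hG).comp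
        (measurable_prodMk_right (y := z))).aestronglyMeasurable)
      (Eventually.of_forall fun p => ?_)
    rw [norm_mul]
    gcongr
    exact abs_inner_feature_le hM _ _ z
  rw [← real_inner_self_eq_norm_sq, integral_prod _ hint, real_inner_comm, ← integral_inner hi]
  refine integral_congr_ae (Eventually.of_forall fun x => ?_)
  simp only
  rw [real_inner_comm, ← integral_inner hi]
  refine integral_congr_ae (Eventually.of_forall fun y => ?_)
  simp only [real_inner_smul_right, real_inner_comm]
  ring

variable [CompleteSpace H] [IsProbabilityMeasure P] {ρ : Measure Y} [IsFiniteMeasure ρ]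

/-- The operator of the kernel `K(x,y) = 𝔼⟨G(x), G(y)⟩` of a square-integrable random feature map
is strictly positive if `f = 0` is the only element of `L²` with `∫ f G dρ = 0` almost surely. -/
theorem isStrictlyPositive_of_feature (hG : Measurable (Function.uncurry G))
    (hM : ∀ y z, ‖G y z‖ ≤ M z) (hM2 : MemLp M 2 P)
    (hinj : ∀ f : Lp ℝ 2 ρ, (∀ᵐ z ∂P, ∫ x, f x • G x z ∂ρ = 0) → f = 0) :
    IsStrictlyPositive (fun x y => ∫ z, (inner ℝ (G x z) (G y z) : ℝ) ∂P) ρ := by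
  set K : Y → Y → ℝ := fun x y => ∫ z, inner ℝ (G x z) (G y z) ∂P with hK
  have hKm : StronglyMeasurable fun p : Y × Y => K p.1 p.2 :=
    (measurable_inner_feature hG).stronglyMeasurable.integral_prod_right'
  have hKb : ∀ x y, |K x y| ≤ ∫ z, M z ^ 2 ∂P := fun x y =>
    norm_integral_le_of_norm_le (f := fun z => (inner ℝ (G x z) (G y z) : ℝ)) hM2.integrable_sq
      (Eventually.of_forall fun z => abs_inner_feature_le hM x y z)
  intro f
  have hf : Integrable f ρ := (Lp.memLp f).integrable one_le_two
  have hfm : StronglyMeasurable f := Lp.stronglyMeasurable f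
  have hKf : ∀ x, Integrable (fun s => K x s * f s) ρ := fun x =>
    hf.bdd_mul (c := ∫ z, M z ^ 2 ∂P)
      (hKm.comp_measurable measurable_prodMk_left).aestronglyMeasurable
      (Eventually.of_forall fun s => hKb x s)
  have hT : MemLp (integralOperator K ρ f) 2 ρ := by
    refine MemLp.of_bound (C := ∫ s, (∫ z, M z ^ 2 ∂P) * |f s| ∂ρ) ?_
      (Eventually.of_forall fun x => ?_)
    · exact (hKm.mul (hfm.comp_measurable measurable_snd)).integral_prod_right'.aestronglyMeasurable
    · refine norm_integral_le_of_norm_le (hf.abs.const_mul _) (Eventually.of_forall fun s => ?_)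
      rw [norm_mul]
      exact mul_le_mul_of_nonneg_right (hKb x s) (abs_nonneg _)
  refine ⟨hKf, hT, fun hne => ?_⟩
  set Φ : (Y × Y) × Ω → ℝ := fun p =>
    f p.1.1 * f p.1.2 * inner ℝ (G p.1.1 p.2) (G p.1.2 p.2) with hΦ
  have hΦi : Integrable Φ ((ρ.prod ρ).prod P) := by
    have hdom := (hf.mul_prod hf).norm.mul_prod hM2.integrable_sq
    refine hdom.mono' ?_ (Eventually.of_forall fun p => ?_)
    · exact (((hfm.comp_measurable (by fun_prop)).mul (hfm.comp_measurable (by fun_prop))).mul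
        (measurable_inner_feature hG).stronglyMeasurable).aestronglyMeasurable
    · rw [norm_mul]
      gcongr
      exact abs_inner_feature_le hM _ _ _
  have hsq : ∀ z, ∫ p, Φ (p, z) ∂(ρ.prod ρ) = ‖∫ x, f x • G x z ∂ρ‖ ^ 2 := fun z =>
    (integral_sq_eq_of_feature hG hM hf z).symm
  have hsqi : Integrable (fun z => ‖∫ x, f x • G x z ∂ρ‖ ^ 2) P := by
    simp only [← hsq]
    exact hΦi.integral_prod_right
  -- Fubini turns the quadratic form of the kernel into a mean square.
  have hinner : inner ℝ f (hT.toLp _) = ∫ z, ‖∫ x, f x • G x z ∂ρ‖ ^ 2 ∂P := by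
    simp only [← hsq]
    rw [← integral_integral_swap hΦi, integral_prod _ hΦi.integral_prod_left, L2.inner_def]
    refine integral_congr_ae ?_
    filter_upwards [hT.coeFn_toLp] with x hx
    rw [hx, integralOperator]
    simp only [RCLike.inner_apply, conj_trivial]
    rw [← integral_mul_const]
    refine integral_congr_ae (Eventually.of_forall fun s => ?_)
    simp only [hΦ]
    rw [integral_const_mul]
    ring
  rw [hinner]
  refine lt_of_le_of_ne (integral_nonneg fun z => by positivity) fun h0 => hne (hinj f ?_)
  have := (integral_eq_zero_iff_of_nonneg (fun z => by positivity) hsqi).1 h0.symm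
  filter_upwards [this] with z hz
  simpa using hz

end FeatureKernel

/-! ### Strict positivity of the tangent kernel. -/

section Positivity

variable {m d : ℕ} {X : Set (Vec d)} {σ : ℝ → ℝ} {L : NNReal} {A B : Measure ℝ}
  [IsProbabilityMeasure A] [IsProbabilityMeasure B]

/-- The exceptional null set of parameters depends on x; Fubini exchanges the quantifiers. -/
theorem ae_ae_differentiableAt_network (hL : LipschitzWith L σ) (ρ : Measure X) [SFinite ρ] :
    ∀ᵐ θ ∂(gaussianInit m d A B), ∀ᵐ x : X ∂ρ,
      DifferentiableAt ℝ (fun η : Param m d => network σ η (x : Vec d)) θ := by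
  have hc : Continuous (Function.uncurry fun (x : X) (η : Param m d) => network σ η (x : Vec d)) :=
    (continuous_network hL.continuous).comp
      (f := fun p : X × Param m d => ((p.1 : Vec d), p.2)) (by fun_prop)
  have hms := measurableSet_of_differentiableAt_with_param ℝ hc
  exact (Measure.ae_ae_comm hms).1
    (Eventually.of_forall fun x => ae_differentiableAt_network hL (x : Vec d))

variable [CompactSpace X]

theorem exists_norm_le_of_compactSpace (X : Set (Vec d)) [CompactSpace X] :
    ∃ R : ℝ, ∀ x : X, ‖(x : Vec d)‖ ≤ R := by
  obtain ⟨R, hR⟩ := (isCompact_iff_compactSpace.2 ‹_› : IsCompact X).isBounded.exists_norm_le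
  exact ⟨R, fun x => hR x x.2⟩

/-- An element of `L²(ρ)` orthogonal to all ridge functions with a Lipschitz non-polynomial
profile vanishes. -/
theorem eq_zero_of_inner_ridge_eq_zero (hL : LipschitzWith L σ)
    (hpoly : ¬ ∃ p : ℝ[X], ∀ t, σ t = p.eval t) {ρ : Measure X} [IsFiniteMeasure ρ]
    (f : Lp ℝ 2 ρ)
    (h : ∀ θ, inner ℝ f (ContinuousMap.toLp 2 ρ ℝ (ridge X ⟨σ, hL.continuous⟩ θ)) = 0) :
    f = 0 := by
  have hℓ := eq_zero_of_ridge_eq_zero hL hpoly ((innerSL ℝ f).comp (ContinuousMap.toLp 2 ρ ℝ)) h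
  have heq := (ContinuousMap.toLp_denseRange ℝ (μ := ρ) ℝ (p := 2) (by simp)).equalizer
    (innerSL ℝ f).continuous (continuous_const (y := (0 : ℝ)))
    (funext fun g => DFunLike.congr_fun hℓ g)
  exact inner_self_eq_zero (𝕜 := ℝ).1 (congrFun heq f)

theorem integrable_tangentKernelAt (hL : LipschitzWith L σ) (hA : MemLp id 2 A) (x x' : X) :
    Integrable (fun θ => tangentKernelAt σ θ (x : Vec d) x') (gaussianInit m d A B) := by
  obtain ⟨R, hR⟩ := exists_norm_le_of_compactSpace X
  exact integrable_inner_feature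
    (G := fun (x : X) θ => gradient (fun η : Param m d => network σ η (x : Vec d)) θ)
    (measurable_gradient_network hL.continuous)
    (fun x θ => norm_gradient_network_le hL (hR x) θ) (memLp_gradBound hA σ L R) x x'

/-- The neural tangent kernel of a network with Gaussian inner weights is strictly positive. -/
theorem isStrictlyPositive_tangentKernel (hL : LipschitzWith L σ)
    (hpoly : ¬ ∃ p : ℝ[X], ∀ t, σ t = p.eval t) (hm : 0 < m) (hA : MemLp id 2 A)
    (ρ : Measure X) [IsFiniteMeasure ρ] :
    IsStrictlyPositive (fun x x' : X => tangentKernel σ (gaussianInit m d A B) x x') ρ := by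
  obtain ⟨R, hR⟩ := exists_norm_le_of_compactSpace X
  have hGm := measurable_gradient_network (m := m) (X := X) hL.continuous
  refine isStrictlyPositive_of_feature (Y := X) (M := gradBound σ L R)
    (G := fun x θ => gradient (fun η : Param m d => network σ η (x : Vec d)) θ) hGm
    (fun x θ => norm_gradient_network_le hL (hR x) θ) (memLp_gradBound hA σ L R) fun f hf => ?_
  have hfi : Integrable f ρ := (Lp.memLp f).integrable one_le_two
  have hdiff := ae_ae_differentiableAt_network (m := m) (A := A) (B := B) hL ρ
  -- The outer-weight derivative of a single neuron already determines f.
  let l : Fin m := ⟨0, hm⟩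
  refine eq_zero_of_inner_ridge_eq_zero hL hpoly f fun p => ?_
  refine eq_zero_of_ae_innerWeight (A := A) (B := B) (h := fun p =>
    inner ℝ f (ContinuousMap.toLp 2 ρ ℝ (ridge X ⟨σ, hL.continuous⟩ p)))
    (continuous_const.inner ((ContinuousMap.toLp 2 ρ ℝ).continuous.comp (continuous_ridge _))) l ?_ p
  filter_upwards [hf, hdiff] with θ hθ hd
  have hGi : Integrable (fun x : X =>
      f x • gradient (fun η : Param m d => network σ η (x : Vec d)) θ) ρ :=
    (hfi.norm.mul_const (gradBound σ L R θ)).mono' (hfi.aestronglyMeasurable.smul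
      (hGm.comp (measurable_prodMk_right (y := θ))).aestronglyMeasurable)
      (Eventually.of_forall fun x => by
        rw [norm_smul]
        gcongr
        exact norm_gradient_network_le hL (hR x) θ)
  have h1 : ∫ x : X, f x * gradient (fun η : Param m d => network σ η (x : Vec d)) θ (Sum.inl l)
      ∂ρ = 0 := by
    have := (EuclideanSpace.proj (Sum.inl l) : Param m d →L[ℝ] ℝ).integral_comp_comm hGi
    rw [hθ, map_zero] at this
    exact this
  have h2 : ∫ x : X, f x * gradient (fun η : Param m d => network σ η (x : Vec d)) θ (Sum.inl l)
      ∂ρ = (1 / Real.sqrt m) * ∫ x : X, f x * σ (preact m (x : Vec d) l θ) ∂ρ := by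
    rw [← integral_const_mul]
    refine integral_congr_ae ?_
    filter_upwards [hd] with x hx
    rw [gradient_network_inl _ _ hx]
    ring
  rw [h2] at h1
  have hm' : 1 / Real.sqrt m ≠ 0 := by positivity
  rw [L2.inner_def, ← (mul_eq_zero.1 h1).resolve_left hm']
  refine integral_congr_ae ?_
  filter_upwards [ContinuousMap.coeFn_toLp (p := 2) (𝕜 := ℝ) ρ
    (ridge X ⟨σ, hL.continuous⟩ (innerWeight θ l, innerBias θ l))] with x hx
  rw [hx, ridge_apply, ContinuousMap.coe_mk, inner_innerWeight_add]
  simp [mul_comm]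

end Positivity

end NTK

theorem mainTheorem9 {d : ℕ} (X : Set (NTK.Vec d)) [CompactSpace X] (σ : ℝ → ℝ)
    (hLip : ∃ L : NNReal, LipschitzWith L σ)
    (hpoly : ¬ ∃ p : Polynomial ℝ, ∀ t, σ t = p.eval t) :
    (∀ (μ : Measure (NTK.Vec d × ℝ)) [μ.IsOpenPosMeasure],
      Integrable (fun θ : NTK.Vec d × ℝ => ‖θ.1‖ ^ 2 + ‖θ.2‖ ^ 2) μ →
        (IsFiniteMeasure μ → ∀ a : NTK.Vec d × ℝ → ℝ, MemLp a 2 μ → ∀ x : X,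
          Integrable (fun θ => a θ * σ (inner ℝ θ.1 (x : NTK.Vec d) + θ.2)) μ) ∧
        (∀ f ∈ NTK.infiniteWidthNetworks σ μ X, Continuous f) ∧
        Dense {g : C(X, ℝ) | ⇑g ∈ NTK.infiniteWidthNetworks σ μ X}) ∧
    (∀ (m : ℕ), 0 < m → ∀ (A B : Measure ℝ) [IsProbabilityMeasure A] [IsProbabilityMeasure B],
      MemLp id 2 A →
        (∀ x : X, ∀ᵐ θ ∂(NTK.gaussianInit m d A B),
          DifferentiableAt ℝ (fun η : NTK.Param m d => NTK.network σ η x) θ) ∧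
        (∀ x x' : X, Integrable (fun θ => NTK.tangentKernelAt σ θ (x : NTK.Vec d) x')
          (NTK.gaussianInit m d A B)) ∧
        ∀ (ρ : Measure X) [IsFiniteMeasure ρ],
          NTK.IsStrictlyPositive
            (fun x x' : X => NTK.tangentKernel σ (NTK.gaussianInit m d A B) x x') ρ) := by

  obtain ⟨L, hL⟩ := hLip
  refine ⟨fun μ _ hμ => ?_, fun m hm A B _ _ hA => ⟨fun x => NTK.ae_differentiableAt_network hL x.1,
    fun x x' => NTK.integrable_tangentKernelAt hL hA x x',
    fun ρ _ => NTK.isStrictlyPositive_tangentKernel hL hpoly hm hA ρ⟩⟩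
  have hμ2 := NTK.memLp_norm_of_integrable_sq hμ
  exact ⟨fun _ a ha x => NTK.integrable_mul_activation hL hμ2 ha x,
    fun f hf => NTK.continuous_of_mem_infiniteWidthNetworks hL hμ2 hf,
    NTK.dense_infiniteWidthNetworks hL hpoly hμ2⟩
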